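/- Let $K$ be a field and let $R$ be an associative $K$-algebra, not necessarily with identity. Let $X$ be a set and, for each $x\in X$, let $\sigma_x$ be a $K$-algebra automorphism of $R$ and let $\delta_x\colon R\to R$ be a $K$-linear $\sigma_x$-derivation, i.e. $\delta_x(ab)=\delta_x(a)b+\sigma_x(a)\delta_x(b)$ for all $a,b\in R$. Put $\mathscr G=\{\sigma_x\}_{x\in X}$ and $\mathscr D=\{\delta_x\}_{x\in X}$. Let $R[X;\mathscr G,\mathscr D]$ be the free skew extension of $R$: the ring of all polynomials $\sum_w r_w w$ (finite sums, $r_w\in R$, $w$ in the free monoid $\langle X\rangle$), with the usual addition and with the multiplication determined by the rule $xr=\sigma_x(r)x+\delta_x(r)$ for $x\in X$, $r\in R$. Let $P$ be the prime radical of $R$, i.e. the intersection of all prime ideals of $R$, and let $P[X;\mathscr G,\mathscr D]$ be the set of all polynomials in $R[X;\mathscr G,\mathscr D]$ with all coefficients in $P$. Assume that: 1. the family $\mathscr G$ is locally finite, i.e. for every finite subset $G_0\subseteq\mathscr G$ and every finitely generated $K$-submodule $V$ of $R$, the $K$-submodule of $R$ spanned by all $\sigma(v)$, with $v\in V$ and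 $\sigma$ in the group generated by $G_0$, is finitely generated; 2. for every $x\in X$ there is $q_x\in K^\times$ with $\delta_x\sigma_x=q_x\sigma_x\delta_x$; 3. $1+q_x+\dots+q_x^n\neq 0$ for all $x\in X$ and all $n>0$. Then $P[X;\mathscr G,\mathscr D]$ is a two-sided ideal of $R[X;\mathscr G,\mathscr D]$, closed under multiplication by scalars from $K$, and it is locally nilpotent: each of its finitely generated subrings is a nilpotent ring. -/

import Mathlib

noncomputable section

/-- A `σ`-derivation of a (not necessarily unital) ring `R`: an additive map `δ` with
`δ (a b) = δ a · b + σ a · δ b`. -/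
structure SkewDerivation {R : Type*} [NonUnitalRing R] (σ : RingAut R) extends R →+ R where
  leibniz : ∀ a b : R, toFun (a * b) = toFun a * b + σ a * toFun b

instance {R : Type*} [NonUnitalRing R] {σ : RingAut R} :
    CoeFun (SkewDerivation σ) (fun _ => R → R) :=
  ⟨fun δ => δ.toAddMonoidHom⟩

/-- A family of automorphisms of a `K`-algebra `R` is locally finite if, for every finite set `G₀`
of its members and every finitely generated submodule `V`, the submodule spanned by the translates
of `V` under the group generated by `G₀` is finitely generated. -/
def IsLocallyFiniteFamily (K : Type*) {R X : Type*} [Field K] [NonUnitalRing R] [Module K R]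
    (σ : X → RingAut R) : Prop :=
  ∀ G₀ : Set (RingAut R), G₀ ⊆ Set.range σ → G₀.Finite →
    ∀ V : Submodule K R, V.FG →
      (Submodule.span K {r : R | ∃ g ∈ Subgroup.closure G₀, ∃ v ∈ V, r = g v}).FG

/-- A proper ideal `Q` of a (not necessarily unital or commutative) ring is prime if `A B ⊆ Q`
implies `A ⊆ Q` or `B ⊆ Q`, for all two-sided ideals `A` and `B`. -/
def TwoSidedIdeal.IsPrimeIdeal {R : Type*} [NonUnitalRing R] (Q : TwoSidedIdeal R) : Prop :=
  Q ≠ ⊤ ∧ ∀ A B : TwoSidedIdeal R, (∀ a ∈ A, ∀ b ∈ B, a * b ∈ Q) → A ≤ Q ∨ B ≤ Q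

/-- The prime radical: the intersection of all prime ideals (all of `R` if there are none). -/
def primeRadical (R : Type*) [NonUnitalRing R] : TwoSidedIdeal R :=
  sInf {Q : TwoSidedIdeal R | Q.IsPrimeIdeal}

/-- A ring is nilpotent if, for some `n`, every product `a₀ a₁ ⋯ aₙ` of `n + 1` elements is zero. -/
def IsNilpotentRing (A : Type*) [NonUnitalRing A] : Prop :=
  ∃ n : ℕ, ∀ (a : A) (l : List A), l.length = n → l.foldl (· * ·) a = 0

/-- A ring is locally nilpotent if every finitely generated subring is a nilpotent ring
(subrings need not contain an identity). -/
def IsLocallyNilpotentRing (A : Type*) [NonUnitalRing A] : Prop :=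
  ∀ s : Finset A, IsNilpotentRing (NonUnitalSubring.closure (s : Set A))

namespace FreeSkew

section Operators

variable {R X : Type*} [NonUnitalRing R]

/-- Left multiplication of polynomials by a coefficient: `a · ∑ r_w w = ∑ (a r_w) w`. -/
def coeffMul : R →+ AddMonoid.End (FreeMonoid X →₀ R) where
  toFun a := Finsupp.mapRange.addMonoidHom (AddMonoidHom.mulLeft a)
  map_zero' := by
    refine Finsupp.addHom_ext fun w r => Finsupp.ext fun v => ?_
    exact zero_mul _
  map_add' a b := by
    refine Finsupp.addHom_ext fun w r => Finsupp.ext fun v => ?_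
    exact add_mul _ _ _

/-- Left multiplication of polynomials by a variable:
`x · ∑ r_w w = ∑ (σ_x(r_w) x w + δ_x(r_w) w)`. -/
def varMul (σ : X → RingAut R) (δ : ∀ x, SkewDerivation (σ x)) (x : X) :
    AddMonoid.End (FreeMonoid X →₀ R) :=
  (Finsupp.mapDomain.addMonoidHom (fun w => FreeMonoid.of x * w)).comp
      (Finsupp.mapRange.addMonoidHom (σ x : R →+ R)) +
    Finsupp.mapRange.addMonoidHom (δ x).toAddMonoidHom

/-- Left multiplication by a polynomial: `(∑ r_w w) · g = ∑ r_w · (w · g)`, where a word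
`w = x₁ ⋯ xₘ` acts through its letters. -/
def polyMul (σ : X → RingAut R) (δ : ∀ x, SkewDerivation (σ x)) :
    (FreeMonoid X →₀ R) →+ AddMonoid.End (FreeMonoid X →₀ R) :=
  Finsupp.liftAddHom fun w =>
    (AddMonoidHom.mulRight (FreeMonoid.lift (varMul σ δ) w)).comp coeffMul

variable (σ : X → RingAut R) (δ : ∀ x, SkewDerivation (σ x))

theorem end_mul_apply {M : Type*} [AddCommGroup M] (f g : AddMonoid.End M) (m : M) :
    (f * g) m = f (g m) := rfl

theorem end_add_apply {M : Type*} [AddCommGroup M] (f g : AddMonoid.End M) (m : M) :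
    (f + g) m = f m + g m := rfl

theorem end_ext {f g : AddMonoid.End (FreeMonoid X →₀ R)}
    (h : ∀ w r, f (Finsupp.single w r) = g (Finsupp.single w r)) : f = g :=
  Finsupp.addHom_ext h

theorem coeffMul_single (a : R) (w : FreeMonoid X) (r : R) :
    coeffMul a (Finsupp.single w r) = Finsupp.single w (a * r) := by
  exact Finsupp.mapRange_single (hf := map_zero (AddMonoidHom.mulLeft a))

theorem varMul_single (x : X) (w : FreeMonoid X) (r : R) :
    varMul σ δ x (Finsupp.single w r) =
      Finsupp.single (FreeMonoid.of x * w) (σ x r) + Finsupp.single w (δ x r) := by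
  change Finsupp.mapDomain (fun w => FreeMonoid.of x * w)
      (Finsupp.mapRange.addMonoidHom (σ x : R →+ R) (Finsupp.single w r)) +
    Finsupp.mapRange.addMonoidHom (δ x).toAddMonoidHom (Finsupp.single w r) = _
  simp [Finsupp.mapDomain_single]

theorem polyMul_single (w : FreeMonoid X) (r : R) :
    polyMul σ δ (Finsupp.single w r) = coeffMul r * FreeMonoid.lift (varMul σ δ) w := by
  simp [polyMul]

theorem coeffMul_mul (a b : R) :
    (coeffMul (a * b) : AddMonoid.End (FreeMonoid X →₀ R)) = coeffMul a * coeffMul b := by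
  refine end_ext fun w r => ?_
  simp only [end_mul_apply, coeffMul_single, mul_assoc]

theorem varMul_mul_coeffMul (x : X) (a : R) :
    varMul σ δ x * coeffMul a =
      coeffMul (σ x a) * varMul σ δ x + coeffMul (δ x a) := by
  refine end_ext fun w r => ?_
  have h : δ x (a * r) = δ x a * r + σ x a * δ x r := (δ x).leibniz a r
  simp only [end_mul_apply, end_add_apply, coeffMul_single, varMul_single,
    map_add, map_mul]
  rw [h, Finsupp.single_add]
  abel

theorem polyMul_coeffMul (a : R) (g : FreeMonoid X →₀ R) :
    polyMul σ δ (coeffMul a g) = coeffMul a * polyMul σ δ g := by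
  induction g using Finsupp.induction_linear with
  | zero => simp
  | add f g hf hg => simp only [map_add, hf, hg, mul_add]
  | single w r => rw [coeffMul_single, polyMul_single, polyMul_single, coeffMul_mul, mul_assoc]

theorem polyMul_varMul (x : X) (g : FreeMonoid X →₀ R) :
    polyMul σ δ (varMul σ δ x g) = varMul σ δ x * polyMul σ δ g := by
  induction g using Finsupp.induction_linear with
  | zero => simp
  | add f g hf hg => simp only [map_add, hf, hg, mul_add]
  | single w r =>
    rw [varMul_single, map_add, polyMul_single, polyMul_single, polyMul_single, ← mul_assoc,
      varMul_mul_coeffMul, map_mul, FreeMonoid.lift_eval_of, add_mul, mul_assoc]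

theorem polyMul_word (w : FreeMonoid X) (g : FreeMonoid X →₀ R) :
    polyMul σ δ (FreeMonoid.lift (varMul σ δ) w g) =
      FreeMonoid.lift (varMul σ δ) w * polyMul σ δ g := by
  induction w using FreeMonoid.inductionOn' with
  | one => simp
  | of_mul x w ih =>
    rw [map_mul, FreeMonoid.lift_eval_of, end_mul_apply, polyMul_varMul, ih, mul_assoc]

theorem polyMul_polyMul (f g : FreeMonoid X →₀ R) :
    polyMul σ δ (polyMul σ δ f g) = polyMul σ δ f * polyMul σ δ g := by
  induction f using Finsupp.induction_linear with
  | zero => simp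
  | add f₁ f₂ h₁ h₂ => simp only [map_add, end_add_apply, h₁, h₂, add_mul]
  | single w r =>
    rw [polyMul_single, end_mul_apply, polyMul_coeffMul, polyMul_word, mul_assoc]

end Operators

end FreeSkew

/-- The free skew extension `R[X; σ, δ]`: polynomials `∑ r_w w` in noncommuting variables, with
coefficients `r_w ∈ R` on the left of the words `w`, multiplied by the rule
`x r = σ_x(r) x + δ_x(r)`. -/
@[nolint unusedArguments]
def FreeSkewExtension {R X : Type*} [NonUnitalRing R] (σ : X → RingAut R)
    (_δ : ∀ x, SkewDerivation (σ x)) : Type _ :=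
  FreeMonoid X →₀ R

namespace FreeSkewExtension

variable {R X : Type*} [NonUnitalRing R] {σ : X → RingAut R} {δ : ∀ x, SkewDerivation (σ x)}

instance : AddCommGroup (FreeSkewExtension σ δ) :=
  inferInstanceAs (AddCommGroup (FreeMonoid X →₀ R))

instance {K : Type*} [Field K] [Module K R] : Module K (FreeSkewExtension σ δ) :=
  inferInstanceAs (Module K (FreeMonoid X →₀ R))

instance : NonUnitalRing (FreeSkewExtension σ δ) :=
  { (inferInstance : AddCommGroup (FreeSkewExtension σ δ)) with
    mul := fun f g => FreeSkew.polyMul σ δ f g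
    left_distrib := fun f g h => map_add (FreeSkew.polyMul σ δ f) g h
    right_distrib := fun f g h =>
      DFunLike.congr_fun (map_add (FreeSkew.polyMul σ δ) f g) h
    zero_mul := fun f => DFunLike.congr_fun (map_zero (FreeSkew.polyMul σ δ)) f
    mul_zero := fun f => map_zero (FreeSkew.polyMul σ δ f)
    mul_assoc := fun f g h =>
      DFunLike.congr_fun (FreeSkew.polyMul_polyMul σ δ f g) h }

/-- The coefficient of a polynomial at a word. -/
def coeff (f : FreeSkewExtension σ δ) (w : FreeMonoid X) : R :=
  (show FreeMonoid X →₀ R from f) w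

/-- The monomial `r w`. -/
def monomial (w : FreeMonoid X) (r : R) : FreeSkewExtension σ δ :=
  (Finsupp.single w r : FreeMonoid X →₀ R)

theorem monomial_one_mul_monomial (a b : R) (v : FreeMonoid X) :
    (monomial 1 a * monomial v b : FreeSkewExtension σ δ) = monomial v (a * b) := by
  change FreeSkew.polyMul σ δ (Finsupp.single 1 a) (Finsupp.single v b) = Finsupp.single v (a * b)
  rw [FreeSkew.polyMul_single, map_one, mul_one, FreeSkew.coeffMul_single]

/-- The defining rule `(a x) (b v) = a σ_x(b) x v + a δ_x(b) v`. -/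
theorem monomial_of_mul_monomial (x : X) (a b : R) (v : FreeMonoid X) :
    (monomial (FreeMonoid.of x) a * monomial v b : FreeSkewExtension σ δ) =
      monomial (FreeMonoid.of x * v) (a * σ x b) + monomial v (a * δ x b) := by
  change FreeSkew.polyMul σ δ (Finsupp.single (FreeMonoid.of x) a) (Finsupp.single v b) =
    (Finsupp.single (FreeMonoid.of x * v) (a * σ x b) + Finsupp.single v (a * δ x b) :
      FreeMonoid X →₀ R)
  rw [FreeSkew.polyMul_single, FreeMonoid.lift_eval_of, FreeSkew.end_mul_apply,
    FreeSkew.varMul_single, map_add, FreeSkew.coeffMul_single, FreeSkew.coeffMul_single]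

/-- The set `P[X; σ, δ]` of polynomials all of whose coefficients lie in the ideal `P` of `R`. -/
def polynomialsOver (σ : X → RingAut R) (δ : ∀ x, SkewDerivation (σ x)) (P : TwoSidedIdeal R) :
    Set (FreeSkewExtension σ δ) :=
  {f | ∀ w : FreeMonoid X, f.coeff w ∈ P}

end FreeSkewExtension

end

/-! Let $P$ be the prime radical. Call an ideal $T \subseteq P$ good if it is a $K$-subspace, is
stable under all $\sigma_x^{\pm1}$ and $\delta_x$, and finitely many polynomials over $T$ always
have only zero products of some fixed length. Good ideals are closed under unions of chains, so
Zorn's lemma gives a maximal one, $T$. Let $W$ be the sum of all ideals nilpotent modulo $T$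
(`nilSum T`). If $W$ is good, then $W = T$, so $T$ is semiprime, hence an intersection of primes,
and $T = P$. Two facts make $W$ good.

Stability under $D = \delta_x$ (`apply_mem_nilSum`). Let $N$ be a $\sigma_x$-invariant ideal
nilpotent modulo $T$. For $a \in N$ and $b \in N^m$, all terms of the Leibniz expansion of
$D^{m+1}(ab)$ fall in $N$, except a multiple of $\sigma_x^m(Da)\,D^m b$ by the $q$-integer $1 + q +
\dots + q^m$. These $q$-integers are invertible, so $(DN)^n \subseteq D^n(N^n) + N$
(`leftPow_map_le`), and $DN + N$ is again nilpotent modulo $T$. Local finiteness lets every element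
of $W$ be placed in such an invariant $N$.

Local nilpotence (`exists_iterProd_subset_coeffsIn`). Take finitely many polynomials over $W$ of
degree at most $d$. A coefficient of a long product is a combination of products of translated
derivatives of the given coefficients, with at most $d$ derivations per factor on average. At least
half of the factors therefore carry at most $2d$ derivations. Such elements span a
finite-dimensional subspace of $W$, which lies in one ideal nilpotent modulo $T$, so long products
have coefficients in $T$, where the claim is already known. -/

noncomputable section

/-! ### Ideals nilpotent modulo an ideal, and their sum -/

section Submodules

variable {K R : Type*} [Field K] [NonUnitalRing R] [Module K R]

/-- A `K`-submodule of `R` which is a two-sided ideal. -/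
def IsIdealSubmodule (N : Submodule K R) : Prop :=
  ∀ r : R, ∀ a ∈ N, r * a ∈ N ∧ a * r ∈ N

theorem IsIdealSubmodule.sup {M N : Submodule K R} (hM : IsIdealSubmodule M)
    (hN : IsIdealSubmodule N) : IsIdealSubmodule (M ⊔ N) := by
  intro r a ha
  obtain ⟨m, hm, n, hn, rfl⟩ := Submodule.mem_sup.1 ha
  rw [mul_add, add_mul]
  exact ⟨Submodule.add_mem_sup (hM r m hm).1 (hN r n hn).1,
    Submodule.add_mem_sup (hM r m hm).2 (hN r n hn).2⟩

/-- An ideal submodule as a two-sided ideal. -/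
def IsIdealSubmodule.toTwoSidedIdeal {N : Submodule K R} (hN : IsIdealSubmodule N) :
    TwoSidedIdeal R :=
  .mk' N N.zero_mem N.add_mem N.neg_mem (fun {x y} hy => (hN x y hy).1)
    (fun {x y} hx => (hN y x hx).2)

theorem IsIdealSubmodule.mem_toTwoSidedIdeal {N : Submodule K R} (hN : IsIdealSubmodule N) {a : R} :
    a ∈ hN.toTwoSidedIdeal ↔ a ∈ N :=
  TwoSidedIdeal.mem_mk' ..

variable [IsScalarTower K R R] [SMulCommClass K R R]

/-- The submodule `N (N (⋯ (N R)))`, with `n` factors `N`. -/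
def leftPow (N : Submodule K R) : ℕ → Submodule K R
  | 0 => ⊤
  | n + 1 => Submodule.map₂ (LinearMap.mul K R) N (leftPow N n)

theorem mul_mem_leftPow {N : Submodule K R} {n : ℕ} {a b : R} (ha : a ∈ N)
    (hb : b ∈ leftPow N n) : a * b ∈ leftPow N (n + 1) :=
  Submodule.apply_mem_map₂ (LinearMap.mul K R) ha hb

theorem leftPow_succ_le {N M : Submodule K R} {n : ℕ} :
    leftPow N (n + 1) ≤ M ↔ ∀ a ∈ N, ∀ b ∈ leftPow N n, a * b ∈ M :=
  Submodule.map₂_le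

theorem leftPow_mono {M N : Submodule K R} (h : M ≤ N) (n : ℕ) : leftPow M n ≤ leftPow N n := by
  induction n with
  | zero => exact le_rfl
  | succ n ih => exact leftPow_succ_le.2 fun a ha b hb => mul_mem_leftPow (h ha) (ih hb)

theorem IsIdealSubmodule.leftPow {N : Submodule K R} (hN : IsIdealSubmodule N) (n : ℕ) :
    IsIdealSubmodule (leftPow N n) := by
  induction n with
  | zero => exact fun _ _ _ => ⟨trivial, trivial⟩
  | succ n ih =>
    intro r
    suffices h : _root_.leftPow N (n + 1) ≤
        (_root_.leftPow N (n + 1)).comap (LinearMap.mulLeft K r) ⊓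
          (_root_.leftPow N (n + 1)).comap (LinearMap.mulRight K r) from fun a ha => h ha
    refine leftPow_succ_le.2 fun a ha b hb => ⟨?_, ?_⟩
    · change r * (a * b) ∈ _root_.leftPow N (n + 1)
      rw [← mul_assoc]
      exact mul_mem_leftPow (hN r a ha).1 hb
    · change a * b * r ∈ _root_.leftPow N (n + 1)
      rw [mul_assoc]
      exact mul_mem_leftPow ha (ih r b hb).2

theorem leftPow_sup_le (N : Submodule K R) {M : Submodule K R} (hM : IsIdealSubmodule M) (n : ℕ) :
    leftPow (N ⊔ M) n ≤ leftPow N n ⊔ M := by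
  induction n with
  | zero => exact le_sup_left
  | succ n ih =>
    refine leftPow_succ_le.2 fun a ha b hb => ?_
    obtain ⟨c, hc, m, hm, rfl⟩ := Submodule.mem_sup.1 ha
    obtain ⟨d, hd, k, hk, rfl⟩ := Submodule.mem_sup.1 (ih hb)
    rw [add_mul, mul_add, add_assoc]
    exact Submodule.add_mem_sup (mul_mem_leftPow hc hd)
      (add_mem (hM c k hk).1 (hM (d + k) m hm).2)

/-- One factor is given up at the splitting point: it is absorbed into the trailing $R$ of the left
power. -/
theorem leftPow_add_succ_le (N : Submodule K R) (n k : ℕ) :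
    leftPow N (n + 1 + k) ≤
      Submodule.map₂ (LinearMap.mul K R) (leftPow N n) (leftPow N k) := by
  induction n with
  | zero =>
    rw [zero_add, add_comm]
    exact leftPow_succ_le.2 fun a _ b hb =>
      Submodule.apply_mem_map₂ (LinearMap.mul K R) trivial hb
  | succ n ih =>
    rw [show n + 1 + 1 + k = n + 1 + k + 1 by omega]
    refine leftPow_succ_le.2 fun a ha b hb => ?_
    suffices h : Submodule.map₂ (LinearMap.mul K R) (leftPow N n) (leftPow N k) ≤
        (Submodule.map₂ (LinearMap.mul K R) (leftPow N (n + 1)) (leftPow N k)).comap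
          (LinearMap.mulLeft K a) from h (ih hb)
    refine Submodule.map₂_le.2 fun c hc d hd => ?_
    change a * (c * d) ∈ Submodule.map₂ (LinearMap.mul K R) (leftPow N (n + 1)) (leftPow N k)
    rw [← mul_assoc]
    exact Submodule.apply_mem_map₂ (LinearMap.mul K R) (mul_mem_leftPow ha hc) hd

/-- `N` is nilpotent modulo `T`. -/
def IsNilpotentMod (N T : Submodule K R) : Prop := ∃ n, leftPow N n ≤ T

theorem IsNilpotentMod.mono {M N T : Submodule K R} (h : IsNilpotentMod N T) (hMN : M ≤ N) :
    IsNilpotentMod M T :=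
  h.imp fun n hn => (leftPow_mono hMN n).trans hn

theorem IsNilpotentMod.trans {M N T : Submodule K R} (h : IsNilpotentMod M N)
    (h' : IsNilpotentMod N T) : IsNilpotentMod M T := by
  obtain ⟨n, hn⟩ := h
  obtain ⟨m, hm⟩ := h'
  refine ⟨(n + 1) * m, le_trans ?_ hm⟩
  clear hm
  induction m with
  | zero => exact le_rfl
  | succ m ih =>
    rw [mul_add_one, add_comm]
    exact (leftPow_add_succ_le M n _).trans (Submodule.map₂_le_map₂ hn ih)

theorem IsNilpotentMod.sup_right {N T : Submodule K R} (hT : IsIdealSubmodule T)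
    (h : IsNilpotentMod N T) : IsNilpotentMod (N ⊔ T) T :=
  h.imp fun n hn => (leftPow_sup_le N hT n).trans (sup_le hn le_rfl)

theorem IsNilpotentMod.sup {M N T : Submodule K R} (hT : IsIdealSubmodule T)
    (hN : IsIdealSubmodule N) (hMT : IsNilpotentMod M (N ⊔ T)) (hNT : IsNilpotentMod N T) :
    IsNilpotentMod (M ⊔ N) T := by
  obtain ⟨n, hn⟩ := hMT
  refine IsNilpotentMod.trans ⟨n, ?_⟩ (hNT.sup_right hT)
  exact (leftPow_sup_le M hN n).trans (sup_le hn le_sup_left)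

/-- The sum of all ideals that are nilpotent modulo `T`. -/
def nilSum (T : Submodule K R) : Submodule K R :=
  sSup {N | IsIdealSubmodule N ∧ IsNilpotentMod N T}

theorem le_nilSum {N T : Submodule K R} (hN : IsIdealSubmodule N) (h : IsNilpotentMod N T) :
    N ≤ nilSum T :=
  le_sSup ⟨hN, h⟩

theorem self_le_nilSum {T : Submodule K R} (hT : IsIdealSubmodule T) : T ≤ nilSum T :=
  le_nilSum hT ⟨1, leftPow_succ_le.2 fun a ha b _ => (hT b a ha).2⟩

/-- The ideals nilpotent modulo $T$ are directed under sums, and finitely generated submodules are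
compact. -/
theorem exists_nilpotent_of_fg_le_nilSum {T V : Submodule K R} (hT : IsIdealSubmodule T)
    (hV : V.FG) (h : V ≤ nilSum T) :
    ∃ N : Submodule K R, IsIdealSubmodule N ∧ IsNilpotentMod N T ∧ V ≤ N := by
  have hc := (CompleteLattice.isCompactElement_iff_le_of_directed_sSup_le _ V).1
    ((Submodule.fg_iff_compact V).1 hV)
  obtain ⟨N, ⟨hN, hN'⟩, hVN⟩ := hc {N | IsIdealSubmodule N ∧ IsNilpotentMod N T}
    ⟨T, hT, 1, leftPow_succ_le.2 fun a ha b _ => (hT b a ha).2⟩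
    (fun M hM N hN => ⟨M ⊔ N, ⟨hM.1.sup hN.1, IsNilpotentMod.sup hT hN.1
      (hM.2.imp fun n hn => hn.trans le_sup_right) hN.2⟩, le_sup_left, le_sup_right⟩) h
  exact ⟨N, hN, hN', hVN⟩

theorem exists_nilpotent_of_mem_nilSum {T : Submodule K R} (hT : IsIdealSubmodule T) {a : R}
    (h : a ∈ nilSum T) :
    ∃ N : Submodule K R, IsIdealSubmodule N ∧ IsNilpotentMod N T ∧ a ∈ N := by
  obtain ⟨N, hN, hN', h⟩ := exists_nilpotent_of_fg_le_nilSum hT (Submodule.fg_span_singleton a)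
    ((Submodule.span_singleton_le_iff_mem ..).2 h)
  exact ⟨N, hN, hN', (Submodule.span_singleton_le_iff_mem ..).1 h⟩

theorem isIdealSubmodule_nilSum {T : Submodule K R} (hT : IsIdealSubmodule T) :
    IsIdealSubmodule (nilSum T) := by
  intro r a ha
  obtain ⟨N, hN, hN', h⟩ := exists_nilpotent_of_mem_nilSum hT ha
  exact ⟨le_nilSum hN hN' (hN r a h).1, le_nilSum hN hN' (hN r a h).2⟩

theorem IsNilpotentMod.le_of_isPrimeIdeal {N T : Submodule K R} (hN : IsIdealSubmodule N)
    (h : IsNilpotentMod N T) {Q : TwoSidedIdeal R} (hQ : Q.IsPrimeIdeal)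
    (hTQ : ∀ a ∈ T, a ∈ Q) : ∀ a ∈ N, a ∈ Q := by
  obtain ⟨n, hn⟩ := h
  replace hn : ∀ a ∈ leftPow N n, a ∈ Q := fun a ha => hTQ a (hn ha)
  clear hTQ
  induction n with
  | zero => exact fun a _ => hn a trivial
  | succ n ih =>
    rcases hQ.2 hN.toTwoSidedIdeal (hN.leftPow n).toTwoSidedIdeal (fun a ha b hb =>
      hn _ (mul_mem_leftPow (hN.mem_toTwoSidedIdeal.1 ha)
        ((hN.leftPow n).mem_toTwoSidedIdeal.1 hb))) with h | h
    · exact fun a ha => h (hN.mem_toTwoSidedIdeal.2 ha)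
    · exact ih fun a ha => h ((hN.leftPow n).mem_toTwoSidedIdeal.2 ha)

theorem mem_primeRadical {R : Type*} [NonUnitalRing R] {a : R} :
    a ∈ primeRadical R ↔ ∀ Q : TwoSidedIdeal R, Q.IsPrimeIdeal → a ∈ Q :=
  TwoSidedIdeal.mem_sInf R

theorem nilSum_le_primeRadical {T : Submodule K R} (hT : IsIdealSubmodule T)
    (hTP : ∀ a ∈ T, a ∈ primeRadical R) : ∀ a ∈ nilSum T, a ∈ primeRadical R := by
  intro a ha
  obtain ⟨N, hN, hN', h⟩ := exists_nilpotent_of_mem_nilSum hT ha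
  exact mem_primeRadical.2 fun Q hQ => hN'.le_of_isPrimeIdeal hN hQ
    (fun b hb => mem_primeRadical.1 (hTP b hb) Q hQ) a h

end Submodules

/-! ### Semiprime ideals and the prime radical -/

section Semiprime

variable {R : Type*} [NonUnitalRing R]

/-- The union of a nonempty chain of two-sided ideals. -/
theorem TwoSidedIdeal.exists_union_of_isChain {c : Set (TwoSidedIdeal R)}
    (hc : IsChain (· ≤ ·) c) (hne : c.Nonempty) :
    ∃ J : TwoSidedIdeal R, ∀ a, a ∈ J ↔ ∃ I ∈ c, a ∈ I := by
  refine ⟨.mk' {a | ∃ I ∈ c, a ∈ I} ?_ ?_ ?_ ?_ ?_, fun a => TwoSidedIdeal.mem_mk' ..⟩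
  · obtain ⟨I, hI⟩ := hne
    exact ⟨I, hI, I.zero_mem⟩
  · rintro x y ⟨I, hI, hx⟩ ⟨I', hI', hy⟩
    rcases hc.total hI hI' with h | h
    · exact ⟨I', hI', I'.add_mem (h hx) hy⟩
    · exact ⟨I, hI, I.add_mem hx (h hy)⟩
  · rintro x ⟨I, hI, hx⟩
    exact ⟨I, hI, I.neg_mem hx⟩
  · rintro x y ⟨I, hI, hx⟩
    exact ⟨I, hI, I.mul_mem_left _ _ hx⟩
  · rintro x y ⟨I, hI, hx⟩
    exact ⟨I, hI, I.mul_mem_right _ _ hx⟩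

/-- A semiprime ideal is an intersection of prime ideals. -/
theorem exists_isPrimeIdeal_of_semiprime {T : TwoSidedIdeal R}
    (hT : ∀ a, a ∉ T → ∃ u ∈ TwoSidedIdeal.span {a}, ∃ v ∈ TwoSidedIdeal.span {a}, u * v ∉ T)
    {a : R} (ha : a ∉ T) : ∃ Q : TwoSidedIdeal R, Q.IsPrimeIdeal ∧ a ∉ Q := by
  choose! u hu v hv huv using hT
  -- An m-sequence: each term is a product of two elements of the ideal generated by the previous
  -- term and stays outside $T$. An ideal maximal among those avoiding the sequence is prime.
  let s : ℕ → R := fun n => n.rec a fun _ b => u b * v b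
  have hs : ∀ n, s n ∉ T := fun n => by
    induction n with
    | zero => exact ha
    | succ n ih => exact huv _ ih
  have hmem : ∀ (A : TwoSidedIdeal R) (n k : ℕ), s n ∈ A → s (n + k) ∈ A := fun A n k h => by
    induction k with
    | zero => exact h
    | succ k ih =>
      exact A.mul_mem_left _ _ ((TwoSidedIdeal.span_le.2 (Set.singleton_subset_iff.2 ih))
        (hv _ (hs _)))
  obtain ⟨Q, hTQ, hQ⟩ := zorn_le_nonempty₀ {Q : TwoSidedIdeal R | ∀ n, s n ∉ Q}
    (fun c hcs hc I hI => by
      obtain ⟨J, hJ⟩ := TwoSidedIdeal.exists_union_of_isChain hc ⟨I, hI⟩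
      refine ⟨J, fun n hn => ?_, fun I hI a ha => (hJ a).2 ⟨I, hI, ha⟩⟩
      obtain ⟨I', hI', h⟩ := (hJ _).1 hn
      exact hcs hI' n h) T hs
  have key : ∀ A : TwoSidedIdeal R, ¬ A ≤ Q → ∃ n, s n ∈ Q ⊔ A := fun A hA => by
    by_contra! h
    exact hA (le_sup_right.trans (hQ.2 (y := Q ⊔ A) h le_sup_left))
  refine ⟨Q, ⟨fun h => hQ.1 0 (h ▸ trivial), fun A B hAB => ?_⟩, hQ.1 0⟩
  by_contra! h
  obtain ⟨i, hi⟩ := key A h.1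
  obtain ⟨j, hj⟩ := key B h.2
  have hi' := hmem _ i j hi
  have hj' := hmem _ j i hj
  rw [add_comm j i] at hj'
  have h1 := (TwoSidedIdeal.span_le.2 (Set.singleton_subset_iff.2 hi')) (hu _ (hs (i + j)))
  have h2 := (TwoSidedIdeal.span_le.2 (Set.singleton_subset_iff.2 hj')) (hv _ (hs (i + j)))
  -- The next term lies in $(Q + A)(Q + B) \subseteq Q + AB \subseteq Q$, which contradicts the
  -- choice of $Q$.
  apply hQ.1 (i + j + 1)
  change u (s (i + j)) * v (s (i + j)) ∈ Q
  obtain ⟨x, hx, y, hy, h1⟩ := TwoSidedIdeal.mem_sup.1 h1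
  obtain ⟨z, hz, w, hw, h2⟩ := TwoSidedIdeal.mem_sup.1 h2
  rw [← h1, ← h2, add_mul, mul_add y]
  exact Q.add_mem (Q.mul_mem_right _ _ hx)
    (Q.add_mem (Q.mul_mem_left _ _ hz) (hAB y hy w hw))

theorem primeRadical_le_of_nilSum_le {K : Type*} [Field K] [Module K R] [IsScalarTower K R R]
    [SMulCommClass K R R] {T : Submodule K R} (hT : IsIdealSubmodule T) (h : nilSum T ≤ T) :
    ∀ a ∈ primeRadical R, a ∈ T := by
  intro a ha
  by_contra haT
  rw [← hT.mem_toTwoSidedIdeal] at haT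
  obtain ⟨Q, hQ, haQ⟩ := exists_isPrimeIdeal_of_semiprime (T := hT.toTwoSidedIdeal) (fun b hb => by
    by_contra! hbT
    refine hb (hT.mem_toTwoSidedIdeal.2 (h ?_))
    let S : Set R := TwoSidedIdeal.span {b}
    -- A ring ideal need not be a $K$-subspace, so it is replaced by its $K$-span, whose square
    -- still lies in $T$.
    have hN : IsIdealSubmodule (Submodule.span K S) := by
      intro r a ha
      induction ha using Submodule.span_induction with
      | mem x hx =>
        exact ⟨Submodule.subset_span (TwoSidedIdeal.mul_mem_left _ _ _ hx),
          Submodule.subset_span (TwoSidedIdeal.mul_mem_right _ _ _ hx)⟩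
      | zero => simp
      | add x y _ _ hx hy => rw [mul_add, add_mul]; exact ⟨add_mem hx.1 hy.1, add_mem hx.2 hy.2⟩
      | smul k x _ hx =>
        rw [mul_smul_comm, smul_mul_assoc]
        exact ⟨Submodule.smul_mem _ _ hx.1, Submodule.smul_mem _ _ hx.2⟩
    refine le_nilSum hN ⟨2, ?_⟩ (Submodule.subset_span (TwoSidedIdeal.subset_span rfl))
    have hle : leftPow (Submodule.span K S) 1 ≤ Submodule.span K S :=
      leftPow_succ_le.2 fun a ha b _ => (hN b a ha).2
    refine (Submodule.map₂_le_map₂_right hle).trans ?_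
    rw [Submodule.map₂_span_span, Submodule.span_le]
    rintro _ ⟨x, hx, y, hy, rfl⟩
    exact hT.mem_toTwoSidedIdeal.1 (hbT x hx y hy)) haT
  exact haQ (mem_primeRadical.1 ha Q hQ)

end Semiprime

/-! ### Automorphisms and orbit spans -/

section Automorphisms

theorem RingAut.apply_inv_apply {R : Type*} [NonUnitalRing R] (g : RingAut R) (r : R) :
    g (g⁻¹ r) = r :=
  g.apply_symm_apply r

theorem RingAut.inv_apply_apply {R : Type*} [NonUnitalRing R] (g : RingAut R) (r : R) :
    g⁻¹ (g r) = r :=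
  g.symm_apply_apply r

variable {K R : Type*} [Field K] [NonUnitalRing R] [Module K R]

/-- The `K`-linear automorphisms of the ring `R` that preserve the submodule `T`. -/
def linearStabilizer (T : Submodule K R) : Subgroup (RingAut R) where
  carrier := {g | (∀ (k : K) (r : R), g (k • r) = k • g r) ∧ ∀ r, g r ∈ T ↔ r ∈ T}
  one_mem' := ⟨fun _ _ => rfl, fun _ => Iff.rfl⟩
  mul_mem' {g h} hg hh :=
    ⟨fun k r => by rw [RingAut.mul_apply, RingAut.mul_apply, hh.1, hg.1],
      fun r => by rw [RingAut.mul_apply, hg.2, hh.2]⟩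
  inv_mem' {g} hg :=
    ⟨fun k r => g.injective (by rw [RingAut.apply_inv_apply, hg.1, RingAut.apply_inv_apply]),
      fun r => by rw [← hg.2, RingAut.apply_inv_apply]⟩

theorem mem_linearStabilizer {T : Submodule K R} {g : RingAut R} :
    g ∈ linearStabilizer T ↔
      (∀ (k : K) (r : R), g (k • r) = k • g r) ∧ ∀ r, g r ∈ T ↔ r ∈ T :=
  Iff.rfl

/-- The span of the translates of `V` under the group `H`. -/
def orbitSpan (H : Subgroup (RingAut R)) (V : Submodule K R) : Submodule K R :=
  Submodule.span K {r : R | ∃ g ∈ H, ∃ v ∈ V, r = g v}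

theorem le_orbitSpan (H : Subgroup (RingAut R)) (V : Submodule K R) : V ≤ orbitSpan H V :=
  fun v hv => Submodule.subset_span ⟨1, H.one_mem, v, hv, rfl⟩

theorem orbitSpan_le {H : Subgroup (RingAut R)} {V W : Submodule K R}
    (hH : H ≤ linearStabilizer W) (hV : V ≤ W) : orbitSpan H V ≤ W := by
  refine Submodule.span_le.2 ?_
  rintro _ ⟨g, hg, v, hv, rfl⟩
  exact ((hH hg).2 v).2 (hV hv)

theorem apply_mem_orbitSpan {H : Subgroup (RingAut R)} {V : Submodule K R} {g : RingAut R}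
    (hg : g ∈ H) (hgK : ∀ (k : K) (r : R), g (k • r) = k • g r) {r : R}
    (hr : r ∈ orbitSpan H V) : g r ∈ orbitSpan H V := by
  induction hr using Submodule.span_induction with
  | mem x hx =>
    obtain ⟨h, hh, v, hv, rfl⟩ := hx
    exact Submodule.subset_span ⟨g * h, H.mul_mem hg hh, v, hv, rfl⟩
  | zero => rw [map_zero]; exact zero_mem _
  | add x y _ _ hx hy => rw [map_add]; exact add_mem hx hy
  | smul k x _ hx => rw [hgK]; exact Submodule.smul_mem _ _ hx

variable [IsScalarTower K R R] [SMulCommClass K R R]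

/-- An automorphism preserving $T$ carries ideals nilpotent modulo $T$ to ideals of the same kind.
-/
theorem linearStabilizer_le_nilSum {T : Submodule K R} (hT : IsIdealSubmodule T) :
    linearStabilizer T ≤ linearStabilizer (nilSum T) := by
  have key : ∀ g ∈ linearStabilizer T, ∀ a ∈ nilSum T, g a ∈ nilSum T := by
    intro g hg a ha
    obtain ⟨N, hN, ⟨n, hn⟩, haN⟩ := exists_nilpotent_of_mem_nilSum hT ha
    let f : R →ₗ[K] R := { toFun := g, map_add' := map_add g, map_smul' := hg.1 }
    refine le_nilSum (N := N.map f) ?_ ⟨n, ?_⟩ ⟨a, haN, rfl⟩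
    · rintro r _ ⟨b, hb, rfl⟩
      have hr : g (g⁻¹ r) = r := RingAut.apply_inv_apply ..
      refine ⟨⟨g⁻¹ r * b, (hN _ _ hb).1, ?_⟩, ⟨b * g⁻¹ r, (hN _ _ hb).2, ?_⟩⟩
      · change g (g⁻¹ r * b) = r * g b
        rw [map_mul, hr]
      · change g (b * g⁻¹ r) = g b * r
        rw [map_mul, hr]
    · have hle : leftPow (N.map f) n ≤ (leftPow N n).map f := by
        clear hn
        induction n with
        | zero => exact fun r _ => ⟨g⁻¹ r, trivial, RingAut.apply_inv_apply ..⟩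
        | succ n ih =>
          refine leftPow_succ_le.2 ?_
          rintro _ ⟨b, hb, rfl⟩ c hc
          obtain ⟨c, hc', rfl⟩ := ih hc
          exact ⟨b * c, mul_mem_leftPow hb hc', map_mul g b c⟩
      refine hle.trans ?_
      rintro _ ⟨b, hb, rfl⟩
      exact (hg.2 b).2 (hn hb)
  refine fun g hg => ⟨hg.1, fun r => ⟨fun h => ?_, key g hg r⟩⟩
  have h' := key g⁻¹ (inv_mem hg) _ h
  rwa [RingAut.inv_apply_apply] at h'

end Automorphisms

/-! ### Skew derivations of nilpotent ideals -/

section Derivations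

variable {K R : Type*} [Field K] [NonUnitalRing R] [Module K R]

/-- The elements `b` with `b, D b, …, D ^ (m - 1) b ∈ N`. -/
def derivLayer (N : Submodule K R) (D : Module.End K R) : ℕ → Submodule K R
  | 0 => ⊤
  | m + 1 => N ⊓ (derivLayer N D m).comap D

variable {N T : Submodule K R} {D : Module.End K R} {g : RingAut R} {q : K}

theorem derivLayer_succ_le (N : Submodule K R) (D : Module.End K R) (m : ℕ) :
    derivLayer N D (m + 1) ≤ derivLayer N D m := by
  induction m with
  | zero => exact le_top
  | succ m ih => exact fun b hb => ⟨hb.1, ih hb.2⟩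

theorem pow_apply_mem_of_mem_derivLayer {m : ℕ} {b : R} (hb : b ∈ derivLayer N D (m + 1)) :
    (D ^ m) b ∈ N := by
  induction m generalizing b with
  | zero => exact hb.1
  | succ m ih => rw [pow_succ]; exact ih hb.2

theorem mul_mem_derivLayer (hN : IsIdealSubmodule N)
    (hD : ∀ a b : R, D (a * b) = D a * b + g a * D b) {m : ℕ} (r : R) {b : R}
    (hb : b ∈ derivLayer N D m) : r * b ∈ derivLayer N D m := by
  induction m generalizing r b with
  | zero => trivial
  | succ m ih =>
    refine ⟨(hN r b hb.1).1, ?_⟩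
    change D (r * b) ∈ derivLayer N D m
    rw [hD]
    exact add_mem (ih _ (derivLayer_succ_le N D m hb)) (ih _ hb.2)

/-- In $D(ab) = Da \cdot b + g(a)\,Db$ the first term keeps the depth of $b$, because layers are
left ideals. The second regains the lost level by induction, since $g(a) \in N$. -/
theorem mul_mem_derivLayer_succ (hN : IsIdealSubmodule N) (hNg : ∀ a ∈ N, g a ∈ N)
    (hD : ∀ a b : R, D (a * b) = D a * b + g a * D b) {m : ℕ} {a b : R} (ha : a ∈ N)
    (hb : b ∈ derivLayer N D m) : a * b ∈ derivLayer N D (m + 1) := by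
  induction m generalizing a b with
  | zero => exact ⟨(hN b a ha).2, trivial⟩
  | succ m ih =>
    refine ⟨(hN b a ha).2, ?_⟩
    change D (a * b) ∈ derivLayer N D (m + 1)
    rw [hD]
    exact add_mem (mul_mem_derivLayer hN hD _ hb) (ih (hNg a ha) hb.2)

theorem pow_apply_mul_sub_mem (hN : IsIdealSubmodule N)
    (hD : ∀ a b : R, D (a * b) = D a * b + g a * D b) {m : ℕ} (r : R) {b : R}
    (hb : b ∈ derivLayer N D m) : (D ^ m) (r * b) - (g ^ m) r * (D ^ m) b ∈ N := by
  induction m generalizing r b with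
  | zero => rw [pow_zero, pow_zero]; simp
  | succ m ih =>
    have h1 := pow_apply_mem_of_mem_derivLayer (mul_mem_derivLayer hN hD (D r) hb)
    have h2 := ih (g r) hb.2
    have h3 : (D ^ (m + 1)) (r * b) - (g ^ (m + 1)) r * (D ^ (m + 1)) b =
        (D ^ m) (D r * b) + ((D ^ m) (g r * D b) - (g ^ m) (g r) * (D ^ m) (D b)) := by
      rw [pow_succ, pow_succ, Module.End.mul_apply, Module.End.mul_apply, RingAut.mul_apply, hD,
        map_add, add_sub_assoc]
    rw [h3]
    exact add_mem h1 h2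

theorem pow_map_smul (hgK : ∀ (k : K) (r : R), g (k • r) = k • g r) (m : ℕ) (k : K) (r : R) :
    (g ^ m) (k • r) = k • (g ^ m) r :=
  (pow_mem (mem_linearStabilizer.2 ⟨hgK, fun _ => by simp⟩ :
    g ∈ linearStabilizer (⊤ : Submodule K R)) m).1 k r

theorem apply_pow_apply (hgK : ∀ (k : K) (r : R), g (k • r) = k • g r)
    (hq : ∀ r, D (g r) = q • g (D r)) (m : ℕ) (r : R) :
    D ((g ^ m) r) = q ^ m • (g ^ m) (D r) := by
  induction m generalizing r with
  | zero => simp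
  | succ m ih =>
    rw [pow_succ g, RingAut.mul_apply, RingAut.mul_apply, ih, hq, pow_map_smul hgK, smul_smul,
      pow_succ]

/-- The Leibniz rule read backwards: $g(r)\,Da = D(ra) - Dr \cdot a$ and $Da \cdot r = D(ar) -
g(a)\,Dr$, where $g$ is surjective. -/
theorem isIdealSubmodule_map_sup (hN : IsIdealSubmodule N) (hNg : ∀ a ∈ N, g a ∈ N)
    (hD : ∀ a b : R, D (a * b) = D a * b + g a * D b) : IsIdealSubmodule (N.map D ⊔ N) := by
  intro r x hx
  obtain ⟨_, ⟨a, ha, rfl⟩, b, hb, rfl⟩ := Submodule.mem_sup.1 hx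
  rw [mul_add, add_mul]
  refine ⟨add_mem ?_ (Submodule.mem_sup_right (hN r b hb).1),
    add_mem ?_ (Submodule.mem_sup_right (hN r b hb).2)⟩
  · obtain ⟨r, rfl⟩ := g.surjective r
    have h : g r * D a = D (r * a) - D r * a := by rw [hD]; abel
    rw [h]
    exact sub_mem (Submodule.mem_sup_left ⟨_, (hN r a ha).1, rfl⟩)
      (Submodule.mem_sup_right (hN _ a ha).1)
  · have h : D a * r = D (a * r) - g a * D r := by rw [hD]; abel
    rw [h]
    exact sub_mem (Submodule.mem_sup_left ⟨_, (hN r a ha).2, rfl⟩)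
      (Submodule.mem_sup_right (hN _ _ (hNg a ha)).2)

variable [IsScalarTower K R R]

/-- Modulo `N`, the iterated skew Leibniz rule for `D ^ (m + 1) (a b)` has a single term, whose
coefficient is a `q`-integer. -/
theorem pow_succ_apply_mul_sub_mem (hN : IsIdealSubmodule N) (hNg : ∀ a ∈ N, g a ∈ N)
    (hgK : ∀ (k : K) (r : R), g (k • r) = k • g r)
    (hD : ∀ a b : R, D (a * b) = D a * b + g a * D b) (hq : ∀ r, D (g r) = q • g (D r))
    {m : ℕ} {a b : R} (ha : a ∈ N) (hb : b ∈ derivLayer N D m) :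
    (D ^ (m + 1)) (a * b) -
      (∑ i ∈ Finset.range (m + 1), q ^ i) • ((g ^ m) (D a) * (D ^ m) b) ∈ N := by
  induction m generalizing a b with
  | zero =>
    have h : (D ^ (0 + 1)) (a * b) -
        (∑ i ∈ Finset.range (0 + 1), q ^ i) • ((g ^ 0) (D a) * (D ^ 0) b) = g a * D b := by
      simp [hD]
    rw [h]
    exact (hN _ _ (hNg a ha)).2
  | succ m ih =>
    have h1 := pow_apply_mul_sub_mem hN hD (D a) hb
    have h2 := ih (hNg a ha) hb.2
    have h3 : (D ^ (m + 1 + 1)) (a * b) = (D ^ (m + 1)) (D a * b) + (D ^ (m + 1)) (g a * D b) := by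
      rw [pow_succ, Module.End.mul_apply, hD, map_add]
    have h4 : (g ^ m) (D (g a)) * (D ^ m) (D b) =
        q • ((g ^ (m + 1)) (D a) * (D ^ (m + 1)) b) := by
      rw [hq, pow_map_smul hgK, smul_mul_assoc]
      rfl
    rw [h4, smul_smul] at h2
    rw [h3, geom_sum_succ, add_smul, one_smul, mul_comm q]
    convert add_mem h1 h2 using 1
    abel

variable [SMulCommClass K R R]

theorem leftPow_le_derivLayer (hN : IsIdealSubmodule N) (hNg : ∀ a ∈ N, g a ∈ N)
    (hD : ∀ a b : R, D (a * b) = D a * b + g a * D b) (m : ℕ) :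
    leftPow N m ≤ derivLayer N D m := by
  induction m with
  | zero => exact le_rfl
  | succ m ih =>
    exact leftPow_succ_le.2 fun a ha b hb => mul_mem_derivLayer_succ hN hNg hD ha (ih hb)

/-- Induction on $n$: multiplying $D^n b$ by one more $Da$ gives, modulo $N$ and up to an invertible
$q$-integer and a power of $q$, the element $D^{n+1}(a'b)$ with $a' = g^{-n}(a) \in N$. -/
theorem leftPow_map_le (hN : IsIdealSubmodule N) (hgN : g ∈ linearStabilizer N)
    (hD : ∀ a b : R, D (a * b) = D a * b + g a * D b) (hq : ∀ r, D (g r) = q • g (D r))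
    (hq_sum : ∀ n : ℕ, ∑ i ∈ Finset.range (n + 1), q ^ i ≠ 0) (n : ℕ) :
    leftPow (N.map D) n ≤ (leftPow N n).map (D ^ n) ⊔ N := by
  have hNg : ∀ a ∈ N, g a ∈ N := fun a => (hgN.2 a).2
  induction n with
  | zero => exact fun r _ => Submodule.mem_sup_left ⟨r, trivial, rfl⟩
  | succ n ih =>
    refine leftPow_succ_le.2 ?_
    rintro _ ⟨a, ha, rfl⟩ c hc
    obtain ⟨_, ⟨b, hb, rfl⟩, d, hd, rfl⟩ := Submodule.mem_sup.1 (ih hc)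
    rw [mul_add]
    refine add_mem ?_ (Submodule.mem_sup_right (hN _ _ hd).1)
    obtain ⟨a', rfl⟩ : ∃ a', (g ^ n) a' = a := ⟨(g ^ n)⁻¹ a, RingAut.apply_inv_apply ..⟩
    have ha' : a' ∈ N := ((pow_mem hgN n).2 a').1 ha
    have h := pow_succ_apply_mul_sub_mem hN hNg hgN.1 hD hq ha'
      (leftPow_le_derivLayer hN hNg hD n hb)
    have h' : (∑ i ∈ Finset.range (n + 1), q ^ i) • ((g ^ n) (D a') * (D ^ n) b) ∈
        (leftPow N (n + 1)).map (D ^ (n + 1)) ⊔ N := by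
      rw [← sub_sub_cancel ((D ^ (n + 1)) (a' * b))
        ((∑ i ∈ Finset.range (n + 1), q ^ i) • ((g ^ n) (D a') * (D ^ n) b))]
      exact sub_mem (Submodule.mem_sup_left ⟨_, mul_mem_leftPow ha' hb, rfl⟩)
        (Submodule.mem_sup_right h)
    rw [apply_pow_apply hgN.1 hq, smul_mul_assoc]
    exact Submodule.smul_mem _ _ ((Submodule.smul_mem_iff _ (hq_sum n)).1 h')

/-- If $N^n \subseteq T$, then $D^n(N^n) \subseteq T$, so $DN$ is nilpotent modulo $N + T$, and $N$
is nilpotent modulo $T$. -/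
theorem IsNilpotentMod.map_sup (hN : IsIdealSubmodule N) (hT : IsIdealSubmodule T)
    (hgN : g ∈ linearStabilizer N) (hTD : ∀ a ∈ T, D a ∈ T)
    (hD : ∀ a b : R, D (a * b) = D a * b + g a * D b) (hq : ∀ r, D (g r) = q • g (D r))
    (hq_sum : ∀ n : ℕ, ∑ i ∈ Finset.range (n + 1), q ^ i ≠ 0)
    (h : IsNilpotentMod N T) : IsNilpotentMod (N.map D ⊔ N) T := by
  refine IsNilpotentMod.sup hT hN (h.imp fun n hn => ?_) h
  refine (leftPow_map_le hN hgN hD hq hq_sum n).trans (sup_le ?_ le_sup_left)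
  rintro _ ⟨a, ha, rfl⟩
  refine Submodule.mem_sup_right ?_
  have : ∀ k : ℕ, (D ^ k) a ∈ T := fun k => by
    induction k with
    | zero => exact hn ha
    | succ k ih => rw [pow_succ']; exact hTD _ ih
  exact this n

/-- The sum of the ideals nilpotent modulo `T` is stable under a `q`-skew derivation whose
automorphism is locally finite. -/
theorem apply_mem_nilSum (hT : IsIdealSubmodule T)
    (hgT : g ∈ linearStabilizer T) (hTD : ∀ a ∈ T, D a ∈ T)
    (hD : ∀ a b : R, D (a * b) = D a * b + g a * D b) (hq : ∀ r, D (g r) = q • g (D r))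
    (hq_sum : ∀ n : ℕ, ∑ i ∈ Finset.range (n + 1), q ^ i ≠ 0)
    (hfg : ∀ V : Submodule K R, V.FG → (orbitSpan (Subgroup.closure {g}) V).FG)
    {a : R} (ha : a ∈ nilSum T) : D a ∈ nilSum T := by
  set H := Subgroup.closure {g} with hH
  have hgH : g ∈ H := Subgroup.subset_closure rfl
  have hHT : H ≤ linearStabilizer T := (Subgroup.closure_le _).2 (Set.singleton_subset_iff.2 hgT)
  -- By local finiteness the whole orbit of $a$ fits into one nilpotent ideal.
  obtain ⟨N, hN, hNT, hle⟩ := exists_nilpotent_of_fg_le_nilSum hT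
    (hfg _ (Submodule.fg_span_singleton a))
    (orbitSpan_le (hHT.trans (linearStabilizer_le_nilSum hT))
      ((Submodule.span_singleton_le_iff_mem ..).2 ha))
  -- The largest $H$-invariant part of $N$. It contains $a$ because $N$ contains the orbit of $a$.
  let N' : Submodule K R :=
    { carrier := {r | ∀ h ∈ H, h r ∈ N}
      add_mem' := fun hx hy h hh => by rw [map_add]; exact add_mem (hx h hh) (hy h hh)
      zero_mem' := fun h _ => by rw [map_zero]; exact zero_mem _
      smul_mem' := fun k x hx h hh => by
        rw [(hHT hh).1]; exact Submodule.smul_mem _ _ (hx h hh) }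
  have hN'N : N' ≤ N := fun r hr => hr 1 (one_mem _)
  have hN' : IsIdealSubmodule N' := fun r x hx =>
    ⟨fun h hh => by rw [map_mul]; exact (hN _ _ (hx h hh)).1,
      fun h hh => by rw [map_mul]; exact (hN _ _ (hx h hh)).2⟩
  have hgN' : g ∈ linearStabilizer N' := by
    refine ⟨hgT.1, fun r => ⟨fun hr h hh => ?_, fun hr h hh => hr (h * g) (mul_mem hh hgH)⟩⟩
    have := hr (h * g⁻¹) (mul_mem hh (inv_mem hgH))
    rwa [RingAut.mul_apply, RingAut.inv_apply_apply] at this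
  refine le_nilSum (isIdealSubmodule_map_sup hN' (fun b => (hgN'.2 b).2) hD)
    ((hNT.mono hN'N).map_sup hN' hT hgN' hTD hD hq hq_sum)
    (Submodule.mem_sup_left ⟨a, fun h hh => hle ?_, rfl⟩)
  exact Submodule.subset_span ⟨h, hh, a, Submodule.mem_span_singleton_self a, rfl⟩

end Derivations

open scoped Pointwise

/-! ### Products of generators and nilpotent rings -/

section ProductSets

variable {A : Type*} [NonUnitalRing A]

/-- The set of all products of `n + 1` elements of `s`. -/
def iterProd (s : Set A) : ℕ → Set A
  | 0 => s
  | n + 1 => s * iterProd s n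

theorem iterProd_add_one_add (s : Set A) (n k : ℕ) :
    iterProd s (n + 1 + k) = iterProd s n * iterProd s k := by
  induction n with
  | zero => rw [zero_add, add_comm]; rfl
  | succ n ih =>
    rw [show n + 1 + 1 + k = n + 1 + k + 1 by omega]
    change s * iterProd s (n + 1 + k) = s * iterProd s n * iterProd s k
    rw [ih, mul_assoc]

theorem iterProd_iterProd (s : Set A) (n m : ℕ) :
    iterProd (iterProd s n) m = iterProd s ((n + 1) * m + n) := by
  induction m with
  | zero => rw [mul_zero, zero_add]; rfl
  | succ m ih =>
    rw [show (n + 1) * (m + 1) + n = n + 1 + ((n + 1) * m + n) by ring, iterProd_add_one_add, ← ih]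
    rfl

theorem finite_iterProd {s : Set A} (hs : s.Finite) (n : ℕ) : (iterProd s n).Finite := by
  induction n with
  | zero => exact hs
  | succ n ih => exact hs.mul ih

theorem foldl_mem_iterProd {s : Set A} (l : List A) (hl : ∀ b ∈ l, b ∈ s) {k : ℕ} {a : A}
    (ha : a ∈ iterProd s k) : l.foldl (· * ·) a ∈ iterProd s (k + l.length) := by
  induction l generalizing k a with
  | nil => exact ha
  | cons b l ih =>
    have h : a * b ∈ iterProd s (k + 1 + 0) := by
      rw [iterProd_add_one_add]
      exact Set.mul_mem_mul ha (hl b List.mem_cons_self)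
    rw [List.length_cons, show k + (l.length + 1) = k + 1 + 0 + l.length by omega]
    exact ih (fun c hc => hl c (List.mem_cons_of_mem b hc)) h

/-- The elements annihilated on the right by all products of `n` elements of `s`. -/
def rightAnnihilated (s : Set A) : ℕ → AddSubgroup A
  | 0 => ⊥
  | n + 1 => ⨅ b ∈ s, (rightAnnihilated s n).comap (AddMonoidHom.mulRight b)

theorem mem_rightAnnihilated_succ {s : Set A} {n : ℕ} {a : A} :
    a ∈ rightAnnihilated s (n + 1) ↔ ∀ b ∈ s, a * b ∈ rightAnnihilated s n := by
  simp [rightAnnihilated, AddSubgroup.mem_iInf]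

theorem mem_rightAnnihilated {s : Set A} {n : ℕ} {a : A}
    (h : ∀ l : List A, (∀ b ∈ l, b ∈ s) → l.length = n → l.foldl (· * ·) a = 0) :
    a ∈ rightAnnihilated s n := by
  induction n generalizing a with
  | zero => exact h [] (by simp) rfl
  | succ n ih =>
    refine mem_rightAnnihilated_succ.2 fun b hb => ih fun l hl hn => ?_
    exact h (b :: l) (by simpa using ⟨hb, hl⟩) (by simp [hn])

theorem rightAnnihilated_le_succ (s : Set A) (n : ℕ) :
    rightAnnihilated s n ≤ rightAnnihilated s (n + 1) := by
  induction n with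
  | zero =>
    intro a ha
    obtain rfl : a = 0 := ha
    exact zero_mem _
  | succ n ih =>
    exact fun a ha => mem_rightAnnihilated_succ.2 fun b hb =>
      ih (mem_rightAnnihilated_succ.1 ha b hb)

/-- Each generator lowers the level by one. A product of generators lowers it further, but the
levels are nested, so one step may always be claimed. -/
theorem mul_mem_rightAnnihilated {s : Set A} {n : ℕ} {g : A} (hg : g ∈ NonUnitalSubring.closure s)
    {f : A} (hf : f ∈ rightAnnihilated s (n + 1)) : f * g ∈ rightAnnihilated s n := by
  induction hg using NonUnitalSubring.closure_induction generalizing f with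
  | mem x hx => exact mem_rightAnnihilated_succ.1 hf x hx
  | zero => rw [mul_zero]; exact zero_mem _
  | add x y _ _ hx hy => rw [mul_add]; exact add_mem (hx hf) (hy hf)
  | neg x _ hx => rw [mul_neg]; exact neg_mem (hx hf)
  | mul x y _ _ hx hy =>
    rw [← mul_assoc]
    exact hy (rightAnnihilated_le_succ s n (hx hf))

/-- A ring generated by a set, all of whose sufficiently long products vanish, is nilpotent. -/
theorem isNilpotentRing_closure {s : Set A} {n : ℕ} (h : iterProd s n ⊆ {0}) :
    IsNilpotentRing (NonUnitalSubring.closure s) := by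
  refine ⟨n, fun a l hl => ?_⟩
  have hmem : ∀ a ∈ NonUnitalSubring.closure s, a ∈ rightAnnihilated s n := by
    intro a ha
    induction ha using NonUnitalSubring.closure_induction with
    | mem x hx =>
      refine mem_rightAnnihilated fun l hl hn => h ?_
      have := foldl_mem_iterProd l hl (k := 0) hx
      rwa [zero_add, hn] at this
    | zero => exact zero_mem _
    | add x y _ _ hx hy => exact add_mem hx hy
    | neg x _ hx => exact neg_mem hx
    | mul x y _ hy hx _ =>
      exact mul_mem_rightAnnihilated hy (rightAnnihilated_le_succ s n hx)
  have key : ∀ (l : List (NonUnitalSubring.closure s)) (a : NonUnitalSubring.closure s),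
      (a : A) ∈ rightAnnihilated s l.length → l.foldl (· * ·) a = 0 := by
    intro l
    induction l with
    | nil => exact fun a ha => Subtype.ext ha
    | cons b l ih => exact fun a ha => ih (a * b) (mul_mem_rightAnnihilated b.2 ha)
  exact key l a (hl ▸ hmem a a.2)

end ProductSets

/-! ### Coefficients of products of polynomials -/

section Coefficients

variable {K R X : Type*} [Field K] [NonUnitalRing R] [Module K R]
  {σ : X → RingAut R} {δ : ∀ x, SkewDerivation (σ x)}

/-- The polynomials with all coefficients in `E`. -/
def coeffsIn (σ : X → RingAut R) (δ : ∀ x, SkewDerivation (σ x)) (E : Submodule K R) :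
    AddSubgroup (FreeSkewExtension σ δ) where
  carrier := {f | ∀ w, f.coeff w ∈ E}
  add_mem' hf hg w := add_mem (hf w) (hg w)
  zero_mem' _ := zero_mem E
  neg_mem' hf w := neg_mem (hf w)

theorem single_mem_coeffsIn {E : Submodule K R} (w : FreeMonoid X) {r : R} (hr : r ∈ E) :
    (Finsupp.single w r : FreeMonoid X →₀ R) ∈ coeffsIn σ δ E := by
  intro v
  change Finsupp.single w r v ∈ E
  classical
  rw [Finsupp.single_apply]
  split_ifs
  exacts [hr, zero_mem E]

theorem map_mem_coeffsIn {E E' : Submodule K R} {φ : AddMonoid.End (FreeMonoid X →₀ R)}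
    (h : ∀ w, ∀ r ∈ E, φ (Finsupp.single w r) ∈ coeffsIn σ δ E') {f : FreeMonoid X →₀ R}
    (hf : f ∈ coeffsIn σ δ E) : φ f ∈ coeffsIn σ δ E' := by
  rw [← f.sum_single, Finsupp.sum, map_sum]
  exact AddSubgroup.sum_mem (coeffsIn σ δ E') fun w _ => h w _ (hf w)

theorem coeffMul_mem_coeffsIn {E E' : Submodule K R} {a : R} (h : ∀ r ∈ E, a * r ∈ E')
    {f : FreeMonoid X →₀ R} (hf : f ∈ coeffsIn σ δ E) :
    FreeSkew.coeffMul a f ∈ coeffsIn σ δ E' := by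
  refine map_mem_coeffsIn (fun w r hr => ?_) hf
  rw [FreeSkew.coeffMul_single]
  exact single_mem_coeffsIn w (h r hr)

theorem varMul_mem_coeffsIn {E E' : Submodule K R} {x : X} (hσ : ∀ r ∈ E, σ x r ∈ E')
    (hδ : ∀ r ∈ E, δ x r ∈ E') {f : FreeMonoid X →₀ R} (hf : f ∈ coeffsIn σ δ E) :
    FreeSkew.varMul σ δ x f ∈ coeffsIn σ δ E' := by
  refine map_mem_coeffsIn (fun w r hr => ?_) hf
  rw [FreeSkew.varMul_single]
  exact AddSubgroup.add_mem (coeffsIn σ δ E') (single_mem_coeffsIn _ (hσ r hr))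
    (single_mem_coeffsIn _ (hδ r hr))

/-- Moving one letter past a coefficient applies $\sigma_x$ or $\delta_x$, at a cost of at most one
step in the filtration; a word costs at most its length. -/
theorem wordMul_mem_coeffsIn {F : ℕ → Submodule K R} {S : Set X}
    (hσ : ∀ x ∈ S, ∀ c, ∀ r ∈ F c, σ x r ∈ F (c + 1))
    (hδ : ∀ x ∈ S, ∀ c, ∀ r ∈ F c, δ x r ∈ F (c + 1)) (w : FreeMonoid X)
    (hw : ∀ x ∈ w.toList, x ∈ S) {c : ℕ} {f : FreeMonoid X →₀ R}
    (hf : f ∈ coeffsIn σ δ (F c)) :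
    FreeMonoid.lift (FreeSkew.varMul σ δ) w f ∈ coeffsIn σ δ (F (c + w.length)) := by
  induction w using FreeMonoid.inductionOn' with
  | one => simpa using hf
  | of_mul x w ih =>
    have hw' : ∀ y ∈ w.toList, y ∈ S := fun y hy => hw y (by simp [hy])
    have hx : x ∈ S := hw x (by simp)
    rw [map_mul, FreeMonoid.lift_eval_of, FreeSkew.end_mul_apply, FreeMonoid.length_mul,
      FreeMonoid.length_of, add_comm 1, ← add_assoc]
    exact varMul_mem_coeffsIn (hσ x hx _) (hδ x hx _) (ih hw')

theorem mul_mem_coeffsIn {E : Submodule K R} {f g : FreeSkewExtension σ δ}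
    (h : ∀ w, f.coeff w ≠ 0 →
      FreeSkew.coeffMul (f.coeff w) (FreeMonoid.lift (FreeSkew.varMul σ δ) w g) ∈
        coeffsIn σ δ E) :
    f * g ∈ coeffsIn σ δ E := by
  let f' : FreeMonoid X →₀ R := f
  have hfg : f * g = ∑ w ∈ f'.support,
      (FreeSkew.coeffMul (f.coeff w) (FreeMonoid.lift (FreeSkew.varMul σ δ) w g) :
        FreeSkewExtension σ δ) := by
    change FreeSkew.polyMul σ δ f' g = _
    rw [FreeSkew.polyMul, Finsupp.liftAddHom_apply, Finsupp.sum]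
    exact AddMonoidHom.finsetSum_apply ..
  rw [hfg]
  exact sum_mem fun w hw => h w (Finsupp.mem_support_iff.1 hw)

/-- The polynomials over a stable ideal form a two-sided ideal. -/
def polynomialIdeal {T : Submodule K R} (hT : IsIdealSubmodule T)
    (hσ : ∀ x, ∀ r ∈ T, σ x r ∈ T) (hδ : ∀ x, ∀ r ∈ T, δ x r ∈ T) :
    TwoSidedIdeal (FreeSkewExtension σ δ) :=
  .mk' (coeffsIn σ δ T) (zero_mem _) add_mem neg_mem
    (fun {f _} hg => mul_mem_coeffsIn fun w _ => coeffMul_mem_coeffsIn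
      (fun r hr => (hT (f.coeff w) r hr).1)
      (wordMul_mem_coeffsIn (F := fun _ => T) (c := 0) (S := Set.univ) (fun x _ _ => hσ x)
        (fun x _ _ => hδ x) w (fun _ _ => trivial) hg))
    -- In $fg$ the coefficients of $f$ stay leftmost, so on this side stability under $\sigma$ and
    -- $\delta$ plays no role.
    (fun {_ _} hf => mul_mem_coeffsIn fun w _ => coeffMul_mem_coeffsIn (E := ⊤)
      (fun r _ => (hT r _ (hf w)).2) (fun _ => trivial))

theorem mem_polynomialIdeal {T : Submodule K R} (hT : IsIdealSubmodule T)
    (hσ : ∀ x, ∀ r ∈ T, σ x r ∈ T) (hδ : ∀ x, ∀ r ∈ T, δ x r ∈ T) {f : FreeSkewExtension σ δ} :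
    f ∈ polynomialIdeal hT hσ hδ ↔ f ∈ coeffsIn σ δ T :=
  TwoSidedIdeal.mem_mk' ..

end Coefficients

/-! ### Products weighted by the number of derivations -/

section WeightedProducts

variable {K R : Type*} [Field K] [NonUnitalRing R] [Module K R]

/-- The span of the products `u₁ u₂ ⋯ uₙ r` with `uᵢ ∈ U jᵢ`, `∑ jᵢ = c` and `r ∈ R`. -/
def weightedProd (U : ℕ → Submodule K R) : ℕ → ℕ → Submodule K R
  | 0, _ => ⊤
  | n + 1, c => Submodule.span K
      {r | ∃ i j, i + j = c ∧ ∃ u ∈ U i, ∃ e ∈ weightedProd U n j, r = u * e}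

theorem mul_mem_weightedProd {U : ℕ → Submodule K R} {n i j c : ℕ} (h : i + j = c) {u e : R}
    (hu : u ∈ U i) (he : e ∈ weightedProd U n j) : u * e ∈ weightedProd U (n + 1) c :=
  Submodule.subset_span ⟨i, j, h, u, hu, e, he, rfl⟩

theorem weightedProd_succ_le {U : ℕ → Submodule K R} {n c : ℕ} {M : Submodule K R}
    (h : ∀ i j, i + j = c → ∀ u ∈ U i, ∀ e ∈ weightedProd U n j, u * e ∈ M) :
    weightedProd U (n + 1) c ≤ M := by
  refine Submodule.span_le.2 ?_
  rintro _ ⟨i, j, hij, u, hu, e, he, rfl⟩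
  exact h i j hij u hu e he

theorem weightedProd_mono {U : ℕ → Submodule K R} (hU : ∀ j, U j ≤ U (j + 1)) (n c : ℕ) :
    weightedProd U n c ≤ weightedProd U n (c + 1) := by
  cases n with
  | zero => exact le_rfl
  | succ n =>
    exact weightedProd_succ_le fun i j h u hu e he =>
      mul_mem_weightedProd (i := i + 1) (by omega) (hU i hu) he

theorem weightedProd_le_comap_ringAut {U : ℕ → Submodule K R} {g : RingAut R}
    {f : Module.End K R} (hf : ∀ r, f r = g r) (hg : ∀ j, ∀ u ∈ U j, g u ∈ U j) (n c : ℕ) :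
    weightedProd U n c ≤ (weightedProd U n c).comap f := by
  induction n generalizing c with
  | zero => exact fun _ _ => trivial
  | succ n ih =>
    refine weightedProd_succ_le fun i j h u hu e he => ?_
    have he' := ih j he
    rw [Submodule.mem_comap, hf] at he' ⊢
    rw [map_mul]
    exact mul_mem_weightedProd h (hg i u hu) he'

theorem weightedProd_le_comap_derivation {U : ℕ → Submodule K R} {g : RingAut R}
    {D : Module.End K R} (hg : ∀ j, ∀ u ∈ U j, g u ∈ U j)
    (hD : ∀ a b : R, D (a * b) = D a * b + g a * D b) (hU : ∀ j, ∀ u ∈ U j, D u ∈ U (j + 1))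
    (n c : ℕ) : weightedProd U n c ≤ (weightedProd U n (c + 1)).comap D := by
  induction n generalizing c with
  | zero => exact fun _ _ => trivial
  | succ n ih =>
    refine weightedProd_succ_le fun i j h u hu e he => ?_
    rw [Submodule.mem_comap, hD]
    exact add_mem (mul_mem_weightedProd (i := i + 1) (by omega) (hU i u hu) he)
      (mul_mem_weightedProd (j := j + 1) (by omega) (hg i u hu) (ih j he))

variable [IsScalarTower K R R] [SMulCommClass K R R]

/-- Pigeonhole: with total weight $c$, at most $c/d$ of the $n$ factors have weight $\geq d$, so at
least $t$ of them lie in $N$. The other factors are absorbed since $N^t$ is an ideal. -/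
theorem weightedProd_le_leftPow {U : ℕ → Submodule K R} {N : Submodule K R}
    (hN : IsIdealSubmodule N) {d : ℕ} (hUN : ∀ j < d, U j ≤ N) (hd : 0 < d) {n c t : ℕ}
    (h : t * d + c ≤ n * d) : weightedProd U n c ≤ leftPow N t := by
  induction n generalizing c t with
  | zero =>
    obtain rfl : t = 0 := by
      rw [zero_mul] at h
      rcases Nat.mul_eq_zero.1 (show t * d = 0 by omega) with h | h <;> omega
    exact le_top
  | succ n ih =>
    refine weightedProd_succ_le fun i j hij u hu e he => ?_
    rw [add_one_mul] at h
    rcases lt_or_ge i d with hi | hi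
    · cases t with
      | zero => trivial
      | succ t =>
        rw [add_one_mul] at h
        exact mul_mem_leftPow (hUN i hi hu) (ih (by omega) he)
    · exact (hN.leftPow t u e (ih (by omega) he)).1

end WeightedProducts

/-! ### Local nilpotence of polynomials over the sum of nilpotent ideals -/

section LocalNilpotence

variable {K R X : Type*} [Field K] [NonUnitalRing R] [Module K R]
  {σ : X → RingAut R} {δ : ∀ x, SkewDerivation (σ x)}

/-- Every finite set of polynomials over `T` has only zero products of some fixed length. -/
def IsLocallyNilpotentOver (σ : X → RingAut R) (δ : ∀ x, SkewDerivation (σ x))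
    (T : Submodule K R) : Prop :=
  ∀ s : Set (FreeSkewExtension σ δ), s.Finite → s ⊆ coeffsIn σ δ T → ∃ n, iterProd s n ⊆ {0}

theorem IsLocallyNilpotentOver.of_iterProd {T W : Submodule K R}
    (hT : IsLocallyNilpotentOver σ δ T)
    (h : ∀ s : Set (FreeSkewExtension σ δ), s.Finite → s ⊆ coeffsIn σ δ W →
      ∃ n, iterProd s n ⊆ coeffsIn σ δ T) : IsLocallyNilpotentOver σ δ W := by
  intro s hs hsW
  obtain ⟨n, hn⟩ := h s hs hsW
  obtain ⟨m, hm⟩ := hT _ (finite_iterProd hs n) hn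
  exact ⟨(n + 1) * m + n, iterProd_iterProd s n m ▸ hm⟩

theorem isLocallyNilpotentOver_bot : IsLocallyNilpotentOver σ δ (⊥ : Submodule K R) :=
  fun _ _ hs => ⟨0, fun f hf => Finsupp.ext (f := (f : FreeMonoid X →₀ R)) fun w => hs hf w⟩

/-- The coefficients of finitely many polynomials. -/
theorem exists_bounds_of_finite {s : Set (FreeSkewExtension σ δ)} (hs : s.Finite) :
    ∃ (S : Finset X) (d : ℕ) (V : Finset R), (∀ f ∈ s, ∀ w, f.coeff w ≠ 0 →
      (∀ x ∈ w.toList, x ∈ S) ∧ w.length ≤ d ∧ f.coeff w ∈ V) ∧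
      ∀ v ∈ V, ∃ f ∈ s, ∃ w, v = f.coeff w := by
  classical
  let supp : FreeSkewExtension σ δ → Finset (FreeMonoid X) :=
    fun f => Finsupp.support (show FreeMonoid X →₀ R from f)
  let B : Finset (FreeMonoid X) := hs.toFinset.biUnion supp
  refine ⟨B.biUnion fun w => w.toList.toFinset, B.sup FreeMonoid.length,
    hs.toFinset.biUnion fun f => (supp f).image f.coeff, fun f hf w hw => ?_, fun v hv => ?_⟩
  · have hw' : w ∈ supp f := Finsupp.mem_support_iff.2 hw
    have hB : w ∈ B := Finset.mem_biUnion.2 ⟨f, hs.mem_toFinset.2 hf, hw'⟩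
    exact ⟨fun x hx => Finset.mem_biUnion.2 ⟨w, hB, List.mem_toFinset.2 hx⟩,
      Finset.le_sup (f := FreeMonoid.length) hB,
      Finset.mem_biUnion.2 ⟨f, hs.mem_toFinset.2 hf, Finset.mem_image_of_mem _ hw'⟩⟩
  · obtain ⟨f, hf, hv⟩ := Finset.mem_biUnion.1 hv
    obtain ⟨w, -, rfl⟩ := Finset.mem_image.1 hv
    exact ⟨f, hs.mem_toFinset.1 hf, w, rfl⟩

/-- Finitely many polynomials have finitely many coefficients, all of which lie in one member of the
chain. -/
theorem IsLocallyNilpotentOver.sSup {c : Set (Submodule K R)} (hc : IsChain (· ≤ ·) c)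
    (hne : c.Nonempty) (h : ∀ T ∈ c, IsLocallyNilpotentOver σ δ T) :
    IsLocallyNilpotentOver σ δ (sSup c) := by
  intro s hs hsc
  obtain ⟨S, d, V, hV, hVs⟩ := exists_bounds_of_finite hs
  have hle : Submodule.span K (V : Set R) ≤ SupSet.sSup c := by
    refine Submodule.span_le.2 fun v hv => ?_
    obtain ⟨f, hf, w, rfl⟩ := hVs v hv
    exact hsc hf w
  obtain ⟨T, hTc, hT⟩ := (CompleteLattice.isCompactElement_iff_le_of_directed_sSup_le _ _).1
    ((Submodule.fg_iff_compact _).1 (Submodule.fg_span V.finite_toSet)) c hne hc.directedOn hle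
  refine h T hTc s hs fun f hf w => ?_
  by_cases hw : f.coeff w = 0
  · rw [hw]; exact zero_mem T
  · exact hT (Submodule.subset_span (hV f hf w hw).2.2)

/-- Submodules generated from `V` by at most `j` of the maps `D x` with `x ∈ S`, and the
group `H`. -/
def derivTower (H : Subgroup (RingAut R)) (D : X → Module.End K R) (S : Finset X)
    (V : Submodule K R) : ℕ → Submodule K R
  | 0 => orbitSpan H V
  | j + 1 => orbitSpan H (derivTower H D S V j ⊔ ⨆ x ∈ S, (derivTower H D S V j).map (D x))

theorem derivTower_le_succ (H : Subgroup (RingAut R)) (D : X → Module.End K R) (S : Finset X)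
    (V : Submodule K R) (j : ℕ) : derivTower H D S V j ≤ derivTower H D S V (j + 1) :=
  le_sup_left.trans (le_orbitSpan ..)

theorem apply_mem_derivTower_succ {H : Subgroup (RingAut R)} {D : X → Module.End K R}
    {S : Finset X} {V : Submodule K R} {x : X} (hx : x ∈ S) {j : ℕ} {u : R}
    (hu : u ∈ derivTower H D S V j) : D x u ∈ derivTower H D S V (j + 1) :=
  le_orbitSpan _ _ (Submodule.mem_sup_right
    (Submodule.mem_iSup_of_mem x (Submodule.mem_iSup_of_mem hx ⟨u, hu, rfl⟩)))

theorem ringAut_apply_mem_derivTower {H : Subgroup (RingAut R)} {D : X → Module.End K R}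
    {S : Finset X} {V : Submodule K R} {g : RingAut R} (hg : g ∈ H)
    (hgK : ∀ (k : K) (r : R), g (k • r) = k • g r) (j : ℕ) {u : R}
    (hu : u ∈ derivTower H D S V j) : g u ∈ derivTower H D S V j := by
  cases j <;> exact apply_mem_orbitSpan hg hgK hu

theorem fg_derivTower {H : Subgroup (RingAut R)} (D : X → Module.End K R) (S : Finset X)
    {V : Submodule K R} (hH : ∀ V : Submodule K R, V.FG → (orbitSpan H V).FG) (hV : V.FG) (j : ℕ) :
    (derivTower H D S V j).FG := by
  induction j with
  | zero => exact hH _ hV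
  | succ j ih => exact hH _ (ih.sup (Submodule.fg_biSup _ _ fun x _ => ih.map (D x)))

theorem derivTower_le {H : Subgroup (RingAut R)} {D : X → Module.End K R} {S : Finset X}
    {V W : Submodule K R} (hH : H ≤ linearStabilizer W) (hD : ∀ x, ∀ r ∈ W, D x r ∈ W)
    (hV : V ≤ W) (j : ℕ) : derivTower H D S V j ≤ W := by
  induction j with
  | zero => exact orbitSpan_le hH hV
  | succ j ih =>
    refine orbitSpan_le hH (sup_le ih (iSup₂_le fun x _ => ?_))
    rintro _ ⟨u, hu, rfl⟩
    exact hD x u (ih hu)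

variable [IsScalarTower K R R] [SMulCommClass K R R]

/-- Long products of finitely many polynomials over `nilSum T` have coefficients in `T`. -/
theorem exists_iterProd_subset_coeffsIn
    (hσK : ∀ (x : X) (k : K) (r : R), σ x (k • r) = k • σ x r)
    (D : X → Module.End K R) (hDδ : ∀ x r, D x r = δ x r)
    (hfin : IsLocallyFiniteFamily K σ) {T : Submodule K R} (hT : IsIdealSubmodule T)
    (hσT : ∀ x, σ x ∈ linearStabilizer T) (hDW : ∀ x, ∀ r ∈ nilSum T, D x r ∈ nilSum T)
    {s : Set (FreeSkewExtension σ δ)} (hs : s.Finite) (hsW : s ⊆ coeffsIn σ δ (nilSum T)) :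
    ∃ n, iterProd s n ⊆ coeffsIn σ δ T := by
  obtain ⟨S, d, V, hV, hVs⟩ := exists_bounds_of_finite hs
  let H : Subgroup (RingAut R) := Subgroup.closure (σ '' S)
  have hσH : ∀ x ∈ S, σ x ∈ H := fun x hx => Subgroup.subset_closure ⟨x, hx, rfl⟩
  have hHT : H ≤ linearStabilizer T := (Subgroup.closure_le _).2 (by
    rintro _ ⟨x, -, rfl⟩
    exact hσT x)
  have hHfg : ∀ V : Submodule K R, V.FG → (orbitSpan H V).FG := fun V hV =>
    hfin _ (Set.image_subset_range _ _) (S.finite_toSet.image σ) V hV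
  let U : ℕ → Submodule K R := derivTower H D S (Submodule.span K (V : Set R))
  have hUσ : ∀ x ∈ S, ∀ j, ∀ u ∈ U j, σ x u ∈ U j := fun x hx j u hu =>
    ringAut_apply_mem_derivTower (hσH x hx) (hσK x) j hu
  have hUmono : ∀ j, U j ≤ U (j + 1) := derivTower_le_succ H D S _
  have hVW : Submodule.span K (V : Set R) ≤ nilSum T := Submodule.span_le.2 fun v hv => by
    obtain ⟨f, hf, w, rfl⟩ := hVs v hv
    exact hsW hf w
  -- The average weight of a factor will be at most $d$, so level $2d$ of the tower captures at
  -- least half of the factors.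
  obtain ⟨N, hN, ⟨k, hk⟩, hUN⟩ := exists_nilpotent_of_fg_le_nilSum hT
    (fg_derivTower D S hHfg (Submodule.fg_span V.finite_toSet) (2 * d))
    (derivTower_le (hHT.trans (linearStabilizer_le_nilSum hT)) hDW hVW (2 * d))
  have hUN' : ∀ j < 2 * d + 1, U j ≤ N := fun j hj =>
    (monotone_nat_of_le_succ hUmono (show j ≤ 2 * d by omega)).trans hUN
  have hEσ : ∀ n, ∀ x ∈ (S : Set X), ∀ c, ∀ r ∈ weightedProd U n c,
      σ x r ∈ weightedProd U n (c + 1) := fun n x hx c r hr =>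
    weightedProd_mono hUmono n c (weightedProd_le_comap_ringAut
      (f := { toFun := σ x, map_add' := map_add (σ x), map_smul' := hσK x }) (fun _ => rfl)
      (hUσ x hx) n c hr)
  have hEδ : ∀ n, ∀ x ∈ (S : Set X), ∀ c, ∀ r ∈ weightedProd U n c,
      δ x r ∈ weightedProd U n (c + 1) := fun n x hx c r hr => by
    rw [← hDδ]
    exact weightedProd_le_comap_derivation (D := D x) (hUσ x hx)
      (fun a b => by simp only [hDδ]; exact (δ x).leibniz a b)
      (fun j u hu => apply_mem_derivTower_succ hx hu) n c hr
  -- Here `iterProd s n` has $n + 1$ factors. The last one is only recorded as having coefficients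
  -- in $R$, which leaves $n$ weighted factors.
  have hprod : ∀ n, iterProd s n ⊆ coeffsIn σ δ (weightedProd U n (n * d)) := by
    intro n
    induction n with
    | zero => exact fun _ _ _ => trivial
    | succ n ih =>
      rintro _ ⟨f, hf, g, hg, rfl⟩
      refine mul_mem_coeffsIn fun w hw => ?_
      obtain ⟨hwS, hwd, hwV⟩ := hV f hf w hw
      have h := wordMul_mem_coeffsIn (hEσ n) (hEδ n) w hwS (ih hg)
      -- The new coefficient enters with weight $0$; its word, of length at most $d$, adds at most
      -- $d$ to the weight of the rest.
      refine coeffMul_mem_coeffsIn (fun r hr => mul_mem_weightedProd (i := 0) (zero_add _)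
        (le_orbitSpan _ _ (Submodule.subset_span hwV)) ?_) h
      exact monotone_nat_of_le_succ (weightedProd_mono hUmono n)
        (by rw [add_one_mul]; omega) hr
  -- With $n = 2k$ the count needs $k(2d+1) + 2kd \leq 2k(2d+1)$, which holds.
  refine ⟨2 * k, fun f hf w => hk (weightedProd_le_leftPow hN hUN' (by omega) ?_ (hprod _ hf w))⟩
  ring_nf
  omega

end LocalNilpotence

end

theorem mainTheorem7 {K R X : Type*} [Field K] [NonUnitalRing R] [Module K R]
    [IsScalarTower K R R] [SMulCommClass K R R]
    (σ : X → RingAut R) (δ : ∀ x, SkewDerivation (σ x))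
    (hσK : ∀ (x : X) (k : K) (r : R), σ x (k • r) = k • σ x r)
    (hδK : ∀ (x : X) (k : K) (r : R), δ x (k • r) = k • δ x r)
    (hfin : IsLocallyFiniteFamily K σ)
    (q : X → Kˣ)
    (hq : ∀ (x : X) (r : R), δ x (σ x r) = (q x : K) • σ x (δ x r))
    (hq_sum : ∀ (x : X) (n : ℕ), 0 < n → ∑ i ∈ Finset.range (n + 1), (q x : K) ^ i ≠ 0) :
    ∃ J : TwoSidedIdeal (FreeSkewExtension σ δ),
      (J : Set (FreeSkewExtension σ δ)) =
          FreeSkewExtension.polynomialsOver σ δ (primeRadical R) ∧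
        (∀ (k : K), ∀ f ∈ J, k • f ∈ J) ∧
        IsLocallyNilpotentRing J := by
  let D : X → Module.End K R := fun x =>
    { toFun := δ x, map_add' := map_add (δ x).toAddMonoidHom, map_smul' := hδK x }
  let good : Set (Submodule K R) := {T | IsIdealSubmodule T ∧ (∀ a ∈ T, a ∈ primeRadical R) ∧
    (∀ x, σ x ∈ linearStabilizer T) ∧ (∀ x, ∀ a ∈ T, D x a ∈ T) ∧ IsLocallyNilpotentOver σ δ T}
  have hbot : (⊥ : Submodule K R) ∈ good := by
    refine ⟨?_, ?_, fun x => ⟨hσK x, fun r => by simp⟩, ?_, isLocallyNilpotentOver_bot⟩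
    · rintro r a rfl
      simp
    · rintro a rfl
      exact zero_mem _
    · rintro x a rfl
      exact map_zero (D x)
  -- Every defining property of a good ideal passes to the union of a chain.
  obtain ⟨T, -, hT⟩ := zorn_le_nonempty₀ good (fun c hcg hc T₀ hT₀ => by
    have hmem : ∀ {a : R}, a ∈ sSup c ↔ ∃ T ∈ c, a ∈ T :=
      Submodule.mem_sSup_of_directed ⟨T₀, hT₀⟩ hc.directedOn
    refine ⟨sSup c, ⟨fun r a ha => ?_, fun a ha => ?_, fun x => ⟨hσK x, fun r => ?_⟩,
      fun x a ha => ?_, .sSup hc ⟨T₀, hT₀⟩ fun T hT => (hcg hT).2.2.2.2⟩, fun T => le_sSup⟩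
    · obtain ⟨T, hT, h⟩ := hmem.1 ha
      exact ⟨hmem.2 ⟨T, hT, ((hcg hT).1 r a h).1⟩, hmem.2 ⟨T, hT, ((hcg hT).1 r a h).2⟩⟩
    · obtain ⟨T, hT, h⟩ := hmem.1 ha
      exact (hcg hT).2.1 a h
    · rw [hmem, hmem]
      exact exists_congr fun T => and_congr_right fun hT => ((hcg hT).2.2.1 x).2 r
    · obtain ⟨T, hT, h⟩ := hmem.1 ha
      exact hmem.2 ⟨T, hT, (hcg hT).2.2.2.1 x a h⟩) ⊥ hbot
  obtain ⟨hTI, hTP, hTσ, hTD, hTN⟩ := hT.prop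
  have hWD : ∀ x, ∀ a ∈ nilSum T, D x a ∈ nilSum T := fun x a ha => by
    refine apply_mem_nilSum hTI (hTσ x) (hTD x) (δ x).leibniz (hq x) (fun n => ?_)
      (fun V hV => hfin _ (Set.singleton_subset_iff.2 ⟨x, rfl⟩) (Set.finite_singleton _) V hV) ha
    -- For $n = 0$ the $q$-integer is $1$, so only $n > 0$ needs the hypothesis.
    rcases n.eq_zero_or_pos with rfl | hn
    · simp
    · exact hq_sum x n hn
  have hW : nilSum T ∈ good :=
    ⟨isIdealSubmodule_nilSum hTI, nilSum_le_primeRadical hTI hTP,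
      fun x => linearStabilizer_le_nilSum hTI (hTσ x), hWD,
      hTN.of_iterProd fun s hs hsW => exists_iterProd_subset_coeffsIn hσK D (fun _ _ => rfl) hfin
        hTI hTσ hWD hs hsW⟩
  -- Maximality forces `nilSum T` into $T$, so $T$ is semiprime and contains the prime radical.
  have hPT : ∀ a, a ∈ T ↔ a ∈ primeRadical R := fun a =>
    ⟨hTP a, primeRadical_le_of_nilSum_le hTI (hT.2 hW (self_le_nilSum hTI)) a⟩
  obtain ⟨J, hmem⟩ : ∃ J : TwoSidedIdeal (FreeSkewExtension σ δ), ∀ f, f ∈ J ↔ f ∈ coeffsIn σ δ T :=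
    ⟨polynomialIdeal hTI (fun x r hr => ((hTσ x).2 r).2 hr) hTD, fun f => mem_polynomialIdeal ..⟩
  refine ⟨J, ?_, fun k f hf => ?_, fun s => ?_⟩
  · ext f
    exact (hmem f).trans (forall_congr' fun w => hPT _)
  · rw [hmem] at hf ⊢
    exact fun w => T.smul_mem k (hf w)
  · obtain ⟨n, hn⟩ := hTN (Subtype.val '' (s : Set J)) (s.finite_toSet.image _) (by
      rintro _ ⟨f, -, rfl⟩
      exact (hmem _).1 f.2)
    refine isNilpotentRing_closure (n := n) fun f hf => Subtype.ext (hn ?_)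
    -- Vanishing of products is known in the whole extension; products taken inside $J$ map to
    -- products there.
    have key : ∀ n, ∀ f ∈ iterProd (s : Set J) n, (f : FreeSkewExtension σ δ) ∈
        iterProd (Subtype.val '' (s : Set J)) n := by
      intro n
      induction n with
      | zero => exact fun f hf => ⟨f, hf, rfl⟩
      | succ n ih =>
        rintro _ ⟨f, hf, g, hg, rfl⟩
        exact ⟨f, ⟨f, hf, rfl⟩, g, ih g hg, rfl⟩
    exact key n f hf
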